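/- Let $\mathcal U$ be a set of $n$ individuals, partitioned into groups $C_1,\dots,C_t$, with a relevance function $R:\mathcal U\to\mathbb R$ whose values are distinct. For all $i\in[n]$ and $k\in[t]$ let an upper bound $u_i^k\in\mathbb N$ be given (there are no lower bound constraints), and let $$\mathcal S=\{\,r:\mathcal U\to[n]\text{ bijective} \;:\; |\{u\in C_k : r(u)\le i\}|\le u_i^k\ \text{ for all } i\in[n],\ k\in[t]\,\}$$ be the set of valid rankings, assumed to be non-empty. Let $V(r,u)=f(r(u))-g(u)$, where $f:[n]\to\mathbb R$ is (weakly) decreasing and $g:\mathcal U\to\mathbb R$ is (weakly) increasing in $R$, i.e. $R(u)\le R(v)$ implies $g(u)\le g(v)$. For a probability distribution $D$ over $\mathcal S$ write $D[u]=\mathbb E_{r\sim D}[V(r,u)]$. A probability distribution $F$ over $\mathcal S$ is called maxmin-fair if for every probability distribution $D$ over $\mathcal S$ and every $u\in\mathcal U$ with $D[u]>F[u]$ there is a $v\in\mathcal U$ with $D[v]<F[v]\le F[u]$. Then a maxmin-fair distribution exists, and for every concave function $\varphi:\mathbb R\to\mathbb R$ every maxmin-fair distribution $F$ over $\mathcal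 S$ maximizes $\sum_{u\in\mathcal U}\varphi(D[u])$ over all probability distributions $D$ over $\mathcal S$. -/

import Mathlib

/-- Expected satisfaction `D[u]` of the individual `u` under the distribution `D` over the finite
set `S` of solutions, where `A s u` is the satisfaction of `u` in the solution `s`.
A distribution over `S` is an element of `stdSimplex ℝ S`: nonnegative weights with sum `1`. -/
def expectedSatisfaction {S U : Type*} [Fintype S] (A : S → U → ℝ) (D : S → ℝ) (u : U) : ℝ :=
  ∑ s, D s * A s u

/-- The distribution `F` over `S` is maxmin-fair for `(U, A)`: no distribution improves the expected
satisfaction of an individual without decreasing it for some other one which is no better off. -/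
def IsMaxminFair {S U : Type*} [Fintype S] (A : S → U → ℝ) (F : S → ℝ) : Prop :=
  F ∈ stdSimplex ℝ S ∧
    ∀ D ∈ stdSimplex ℝ S, ∀ u : U,
      expectedSatisfaction A F u < expectedSatisfaction A D u →
        ∃ v : U, expectedSatisfaction A D v < expectedSatisfaction A F v ∧
          expectedSatisfaction A F v ≤ expectedSatisfaction A F u

/-- The input of a ranking problem with group-fairness constraints: the individuals `U` are
to be placed on the positions `Fin n` and are partitioned into the groups
`C k = {u | group u = k}`, for `k : Fin t`. Positions are indexed from `0`, so that the
positions up to and including `i : Fin n` are the first `i + 1` ones. -/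
structure RankingInstance (U : Type*) (n t : ℕ) where
  /-- the group of an individual -/
  group : U → Fin t
  /-- the relevance function `R` -/
  relevance : U → ℝ
  relevance_injective : Function.Injective relevance
  /-- lower bound on the number of individuals of a group in the positions up to a given one -/
  lower : Fin n → Fin t → ℕ
  /-- upper bound on the number of individuals of a group in the positions up to a given one -/
  upper : Fin n → Fin t → ℕ
  /-- the intrinsic utility `f` of a position -/
  posUtility : Fin n → ℝ
  posUtility_antitone : Antitone posUtility
  /-- the merit `g` of an individual -/
  merit : U → ℝ
  merit_le_merit : ∀ u v : U, relevance u ≤ relevance v → merit u ≤ merit v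

namespace RankingInstance

variable {U : Type*} [Fintype U] {n t : ℕ}

/-- The number of individuals of the group `k` that the ranking `r` places on the positions up to
and including `i`. -/
def groupCount (I : RankingInstance U n t) (r : U ≃ Fin n) (i : Fin n) (k : Fin t) : ℕ :=
  (Finset.univ.filter fun u : U => I.group u = k ∧ r u ≤ i).card

/-- The set of valid rankings. -/
def validRankings (I : RankingInstance U n t) : Set (U ≃ Fin n) :=
  {r | ∀ i k, I.lower i k ≤ I.groupCount r i k ∧ I.groupCount r i k ≤ I.upper i k}

noncomputable instance (I : RankingInstance U n t) : Fintype I.validRankings :=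
  Fintype.ofFinite _

/-- The value function `V(r, u) = f(r(u)) - g(u)` on valid rankings. -/
def value (I : RankingInstance U n t) (r : I.validRankings) (u : U) : ℝ :=
  I.posUtility (r.1 u) - I.merit u

/-- Only upper bound constraints are present: every lower bound is the trivial one. -/
def OnlyUpperBounds (I : RankingInstance U n t) : Prop :=
  ∀ i k, I.lower i k = 0

end RankingInstance

/-! The key is a greedy property (`IsGreedy`): for every weighting `κ` one distribution maximizes
the total satisfaction of all upper level sets of `κ` at once, while the grand total is constant.
With upper bounds only, it comes from filling positions from the top, always with an admissible
individual of largest `κ`. The resulting prefixes dominate those of every valid ranking on every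
level set (`IsGreedyPrefix.exists_insert`), and a decreasing `f` turns this into domination of
utilities. The rest is convexity. Call `F` tight if it maximizes the total over each lower level set
of its own satisfactions. Tight distributions are fair, and the minimizer of the Euclidean norm is
tight. Conversely, fair distributions are tight (`tight_of_isMaxminFair`, by separation of convex
sets). For a tight `F`, the supergradients of `φ` are decreasing in satisfaction, so Abel summation
bounds the first-order change of the welfare sum by zero. -/

open Filter Topology

/-! ### Abel summation over level sets. -/

section AbelSummation

variable {U : Type*}

/-- If all sums of `d` over the upper level sets of `κ` are nonnegative, then so is the sum of `d`
with weights that are nonnegative and monotone in `κ`. -/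
theorem sum_mul_nonneg_of_upper_sums_nonneg (κ d : U → ℝ) (s : Finset U) (ψ : U → ℝ)
    (hψ : ∀ u ∈ s, ∀ v ∈ s, κ u ≤ κ v → ψ u ≤ ψ v) (hψ0 : ∀ u ∈ s, 0 ≤ ψ u)
    (hd : ∀ v ∈ s, 0 ≤ ∑ u ∈ s with κ v ≤ κ u, d u) :
    0 ≤ ∑ u ∈ s, ψ u * d u := by
  classical
  induction s using Finset.strongInduction generalizing ψ with
  | H s ih =>
    rcases s.eq_empty_or_nonempty with rfl | hs
    · simp
    obtain ⟨m, hm, hmin⟩ := s.exists_min_image κ hs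
    -- Subtracting the least weight kills the bottom level of `κ`, which leaves a smaller set with
    -- the same upper sums.
    have hrest : 0 ≤ ∑ u ∈ s with κ m < κ u, (ψ u - ψ m) * d u := by
      refine ih _ ?_ (fun u => ψ u - ψ m) ?_ ?_ ?_
      · refine Finset.filter_ssubset.2 ⟨m, hm, lt_irrefl _⟩
      · intro u hu v hv h
        simp only [Finset.mem_filter] at hu hv
        linarith [hψ u hu.1 v hv.1 h]
      · intro u hu
        simp only [Finset.mem_filter] at hu
        linarith [hψ m hm u hu.1 hu.2.le]
      · intro v hv
        simp only [Finset.mem_filter] at hv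
        convert hd v hv.1 using 2
        ext u
        simp only [Finset.mem_filter]
        constructor
        · rintro ⟨⟨h1, _⟩, h3⟩
          exact ⟨h1, h3⟩
        · rintro ⟨h1, h3⟩
          exact ⟨⟨h1, hv.2.trans_le h3⟩, h3⟩
    have hdrop : ∑ u ∈ s with κ m < κ u, (ψ u - ψ m) * d u = ∑ u ∈ s, (ψ u - ψ m) * d u := by
      refine Finset.sum_subset (Finset.filter_subset _ _) ?_
      intro u hu hnot
      have hle : κ u ≤ κ m := by
        by_contra h
        exact hnot (Finset.mem_filter.2 ⟨hu, not_le.1 h⟩)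
      rw [le_antisymm (hψ u hu m hm hle) (hψ m hm u hu (hmin u hu)), sub_self, zero_mul]
    have htot : 0 ≤ ∑ u ∈ s, d u := by
      have h := hd m hm
      rwa [Finset.filter_true_of_mem hmin] at h
    have hsplit : ∑ u ∈ s, ψ u * d u = ψ m * ∑ u ∈ s, d u + ∑ u ∈ s, (ψ u - ψ m) * d u := by
      rw [Finset.mul_sum, ← Finset.sum_add_distrib]
      exact Finset.sum_congr rfl fun u _ => by ring
    rw [hsplit, ← hdrop]
    exact add_nonneg (mul_nonneg (hψ0 m hm) htot) hrest

variable [Fintype U]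

/-- If all sums of `d` over the upper level sets of `κ` are nonnegative and the total is zero, then
the sum of `d` with weights monotone in `κ` is nonnegative. -/
theorem sum_mul_nonneg_of_sum_eq_zero (κ d ψ : U → ℝ)
    (hψ : ∀ u v, κ u ≤ κ v → ψ u ≤ ψ v)
    (hd : ∀ a, 0 ≤ ∑ u with a ≤ κ u, d u) (h0 : ∑ u, d u = 0) :
    0 ≤ ∑ u, ψ u * d u := by
  rcases isEmpty_or_nonempty U with hU | hU
  · simp
  obtain ⟨m, hm⟩ := Finite.exists_min ψ
  -- As the total of `d` is zero, shifting the weights by a constant to make them nonnegative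
  -- changes nothing.
  have h := sum_mul_nonneg_of_upper_sums_nonneg κ d Finset.univ (fun u => ψ u - ψ m)
    (fun u _ v _ huv => sub_le_sub_right (hψ u v huv) _) (fun u _ => sub_nonneg.2 (hm u))
    (fun v _ => hd (κ v))
  simpa only [sub_mul, Finset.sum_sub_distrib, ← Finset.mul_sum, h0, mul_zero, sub_zero] using h

/-- Equality case: if in addition the sum with weights `κ` is nonpositive, then all sums
of `d` over the upper level sets of `κ` vanish. -/
theorem upper_sum_nonpos_of_sum_mul_nonpos (κ d : U → ℝ)
    (hd : ∀ a, 0 ≤ ∑ u with a ≤ κ u, d u) (h0 : ∑ u, d u = 0)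
    (hκ : ∑ u, κ u * d u ≤ 0) (a : ℝ) : ∑ u with a ≤ κ u, d u ≤ 0 := by
  have hgap : ∀ᶠ ε in 𝓝[>] (0 : ℝ), ∀ u, κ u < a → κ u + ε ≤ a := by
    rw [Filter.eventually_all]
    intro u
    by_cases hu : κ u < a
    · have : Set.Ioo (0 : ℝ) (a - κ u) ∈ 𝓝[>] (0 : ℝ) := Ioo_mem_nhdsGT (sub_pos.2 hu)
      filter_upwards [this] with ε hε _
      linarith [hε.2]
    · exact Filter.Eventually.of_forall fun ε h => absurd h hu
  obtain ⟨ε, hε, hε0⟩ := (hgap.and self_mem_nhdsWithin).exists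
  have hε0 : 0 < ε := hε0
  -- Lowering the level set by `ε`, at most the gap below it, keeps the weights monotone in `κ`; a
  -- positive sum over that level set would make the new weighted sum negative.
  have h := sum_mul_nonneg_of_sum_eq_zero κ d (fun u => κ u - if a ≤ κ u then ε else 0)
    (fun u v huv => by
      split_ifs with h1 h2 h2
      · linarith
      · linarith
      · linarith [hε u (not_le.1 h1)]
      · linarith) hd h0
  have hsplit : ∑ u, (κ u - if a ≤ κ u then ε else 0) * d u =
      ∑ u, κ u * d u - ε * ∑ u with a ≤ κ u, d u := by
    rw [Finset.mul_sum, Finset.sum_filter, ← Finset.sum_sub_distrib]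
    exact Finset.sum_congr rfl fun u _ => by split_ifs <;> ring
  rw [hsplit] at h
  by_contra! hpos
  nlinarith [mul_pos hε0 hpos]

end AbelSummation

/-! ### Greedy systems: fairness and tightness. -/

section Greedy

variable {S U : Type*} [Fintype S]

theorem expectedSatisfaction_add_smul (A : S → U → ℝ) (a b : ℝ) (D E : S → ℝ) (u : U) :
    expectedSatisfaction A (a • D + b • E) u =
      a * expectedSatisfaction A D u + b * expectedSatisfaction A E u := by
  simp only [expectedSatisfaction, Finset.mul_sum, ← Finset.sum_add_distrib]
  exact Finset.sum_congr rfl fun s _ => by simp; ring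

theorem continuous_expectedSatisfaction (A : S → U → ℝ) :
    Continuous fun D : S → ℝ => expectedSatisfaction A D := by
  unfold expectedSatisfaction
  fun_prop

theorem sum_expectedSatisfaction (A : S → U → ℝ) (D : S → ℝ) (T : Finset U) :
    ∑ u ∈ T, expectedSatisfaction A D u = ∑ s, D s * ∑ u ∈ T, A s u := by
  simp only [expectedSatisfaction, Finset.mul_sum]
  exact Finset.sum_comm

variable [Fintype U]

/-- For every weighting `κ` of the individuals some distribution maximizes the total satisfaction of
all upper level sets of `κ` at once, and the total satisfaction of all individuals is constant. In
other words, the satisfaction vectors form the base polytope of a submodular function. -/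
structure IsGreedy (A : S → U → ℝ) : Prop where
  exists_forall_upper_sum_le : ∀ κ : U → ℝ, ∃ E ∈ stdSimplex ℝ S, ∀ D ∈ stdSimplex ℝ S, ∀ a : ℝ,
    ∑ u with a ≤ κ u, expectedSatisfaction A D u ≤ ∑ u with a ≤ κ u, expectedSatisfaction A E u
  sum_eq : ∀ D ∈ stdSimplex ℝ S, ∀ E ∈ stdSimplex ℝ S,
    ∑ u, expectedSatisfaction A D u = ∑ u, expectedSatisfaction A E u

/-- Expectation is linear, so a solution that is optimal on each level set also beats every mixture.
-/
theorem isGreedy_of_pure (A : S → U → ℝ)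
    (h : ∀ κ : U → ℝ, ∃ s₀, ∀ s, ∀ a : ℝ,
      ∑ u with a ≤ κ u, A s u ≤ ∑ u with a ≤ κ u, A s₀ u)
    (hsum : ∀ s s', ∑ u, A s u = ∑ u, A s' u) : IsGreedy A := by
  classical
  constructor
  · intro κ
    obtain ⟨s₀, hs₀⟩ := h κ
    refine ⟨Pi.single s₀ 1, single_mem_stdSimplex ℝ s₀, fun D hD a => ?_⟩
    rw [sum_expectedSatisfaction, sum_expectedSatisfaction]
    calc ∑ s, D s * ∑ u with a ≤ κ u, A s u
        ≤ ∑ s, D s * ∑ u with a ≤ κ u, A s₀ u :=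
          Finset.sum_le_sum fun s _ => mul_le_mul_of_nonneg_left (hs₀ s a) (hD.1 s)
      _ = ∑ u with a ≤ κ u, A s₀ u := by rw [← Finset.sum_mul, hD.2, one_mul]
      _ = _ := by simp [Pi.single_apply]
  · intro D hD E hE
    rw [sum_expectedSatisfaction, sum_expectedSatisfaction]
    obtain ⟨s₀, -⟩ := h 0
    simp only [fun s => hsum s s₀, ← Finset.sum_mul, hD.2, hE.2]

namespace IsGreedy

variable {A : S → U → ℝ}

/-- A distribution that maximizes the total satisfaction of its lower level sets is maxmin-fair. -/
theorem isMaxminFair_of_tight {F : S → ℝ} (hF : F ∈ stdSimplex ℝ S)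
    (h : ∀ a : ℝ, ∀ D ∈ stdSimplex ℝ S,
      ∑ u with expectedSatisfaction A F u ≤ a, expectedSatisfaction A D u ≤
        ∑ u with expectedSatisfaction A F u ≤ a, expectedSatisfaction A F u) :
    IsMaxminFair A F := by
  refine ⟨hF, fun D hD u hu => ?_⟩
  by_contra! hno
  refine (h (expectedSatisfaction A F u) D hD).not_gt (Finset.sum_lt_sum ?_ ⟨u, by simp, hu⟩)
  intro v hv
  by_contra! hlt
  exact (hno v hlt).not_ge (Finset.mem_filter.1 hv).2

/-- The distribution whose satisfaction vector has minimal norm is maxmin-fair. -/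
theorem exists_isMaxminFair (hA : IsGreedy A) : ∃ F, IsMaxminFair A F := by
  obtain ⟨E₀, hE₀, -⟩ := hA.exists_forall_upper_sum_le 0
  have hcont : Continuous fun D : S → ℝ => ∑ u, expectedSatisfaction A D u ^ 2 :=
    continuous_finsetSum _ fun u _ =>
      ((continuous_apply u).comp (continuous_expectedSatisfaction A)).pow 2
  obtain ⟨F, hF, hmin⟩ := (isCompact_stdSimplex ℝ S).exists_isMinOn ⟨E₀, hE₀⟩ hcont.continuousOn
  refine ⟨F, isMaxminFair_of_tight hF fun a D hD => ?_⟩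
  obtain ⟨E, hE, hmax⟩ := hA.exists_forall_upper_sum_le fun u => -expectedSatisfaction A F u
  set x := expectedSatisfaction A F with hx
  set y := expectedSatisfaction A E with hy
  -- First-order optimality of the norm minimizer along the segment from `F` to `E`.
  have hfirst : 0 ≤ ∑ u, x u * (y u - x u) := by
    have hquad : ∀ t ∈ Set.Ioo (0 : ℝ) 1,
        0 ≤ 2 * ∑ u, x u * (y u - x u) + t * ∑ u, (y u - x u) ^ 2 := by
      intro t ht
      have hmem : (1 - t) • F + t • E ∈ stdSimplex ℝ S :=
        convex_stdSimplex ℝ S hF hE (by linarith [ht.2]) ht.1.le (by ring)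
      have h : ∑ u, x u ^ 2 ≤ ∑ u, expectedSatisfaction A ((1 - t) • F + t • E) u ^ 2 := hmin hmem
      have hexp : ∑ u, expectedSatisfaction A ((1 - t) • F + t • E) u ^ 2 = ∑ u, x u ^ 2 +
          t * (2 * ∑ u, x u * (y u - x u) + t * ∑ u, (y u - x u) ^ 2) := by
        simp only [Finset.mul_sum, ← Finset.sum_add_distrib]
        refine Finset.sum_congr rfl fun u _ => ?_
        rw [expectedSatisfaction_add_smul, ← hx, ← hy]
        ring
      rw [hexp] at h
      exact nonneg_of_mul_nonneg_right (by linarith) ht.1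
    have hlim : Tendsto (fun t : ℝ => 2 * ∑ u, x u * (y u - x u) + t * ∑ u, (y u - x u) ^ 2)
        (𝓝[>] 0) (𝓝 (2 * ∑ u, x u * (y u - x u) + 0 * ∑ u, (y u - x u) ^ 2)) := by
      refine Tendsto.mono_left (Continuous.tendsto ?_ 0) nhdsWithin_le_nhds
      fun_prop
    have h := ge_of_tendsto hlim
      (Filter.mem_of_superset (Ioo_mem_nhdsGT one_pos) hquad)
    linarith
  have hzero := upper_sum_nonpos_of_sum_mul_nonpos (fun u => -x u) (fun u => y u - x u)
    (fun b => by
      rw [Finset.sum_sub_distrib]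
      exact sub_nonneg.2 (hmax F hF b))
    (by rw [Finset.sum_sub_distrib, hA.sum_eq E hE F hF, sub_self])
    (by simpa only [neg_mul, Finset.sum_neg_distrib, Left.neg_nonpos_iff] using hfirst) (-a)
  have hDE := hmax D hD (-a)
  simp only [neg_le_neg_iff, Finset.sum_sub_distrib] at hzero hDE
  linarith

/-- Every distribution can be dominated on `T` by one that maximizes the total satisfaction
of `T`. -/
theorem exists_ge_on_maximizing (hA : IsGreedy A) {F : S → ℝ} (hF : F ∈ stdSimplex ℝ S)
    (T : Finset U) : ∃ E ∈ stdSimplex ℝ S,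
      (∀ u ∈ T, expectedSatisfaction A F u ≤ expectedSatisfaction A E u) ∧
      ∀ D ∈ stdSimplex ℝ S,
        ∑ u ∈ T, expectedSatisfaction A D u ≤ ∑ u ∈ T, expectedSatisfaction A E u := by
  classical
  by_contra! hno
  set x := expectedSatisfaction A F with hx
  have hsumcont : Continuous fun D : S → ℝ => ∑ u ∈ T, expectedSatisfaction A D u :=
    continuous_finsetSum _ fun u _ => (continuous_apply u).comp (continuous_expectedSatisfaction A)
  let M : Set (S → ℝ) := stdSimplex ℝ S ∩ {E | ∀ D ∈ stdSimplex ℝ S,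
    ∑ u ∈ T, expectedSatisfaction A D u ≤ ∑ u ∈ T, expectedSatisfaction A E u}
  let K : Set (U → ℝ) := {y | ∀ u ∈ T, x u ≤ y u}
  have hMcomp : IsCompact M := by
    refine (isCompact_stdSimplex ℝ S).inter_right ?_
    simp only [Set.ofPred_forall]
    exact isClosed_iInter fun D => isClosed_iInter fun _ => isClosed_le continuous_const hsumcont
  have hMconv : Convex ℝ (expectedSatisfaction A '' M) := by
    rintro _ ⟨E, hE, rfl⟩ _ ⟨E', hE', rfl⟩ a b ha hb hab
    refine ⟨a • E + b • E', ⟨convex_stdSimplex ℝ S hE.1 hE'.1 ha hb hab, fun D hD => ?_⟩, ?_⟩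
    · simp only [expectedSatisfaction_add_smul, Finset.sum_add_distrib, ← Finset.mul_sum]
      have h := add_le_add (mul_le_mul_of_nonneg_left (hE.2 D hD) ha)
        (mul_le_mul_of_nonneg_left (hE'.2 D hD) hb)
      rwa [← add_mul, hab, one_mul] at h
    · ext u
      simp [expectedSatisfaction_add_smul]
  have hKconv : Convex ℝ K := by
    intro y hy z hz a b ha hb hab u hu
    have h := add_le_add (mul_le_mul_of_nonneg_left (hy u hu) ha)
      (mul_le_mul_of_nonneg_left (hz u hu) hb)
    rwa [← add_mul, hab, one_mul] at h
  have hKclosed : IsClosed K := by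
    simp only [K, Set.ofPred_forall]
    exact isClosed_iInter fun u => isClosed_iInter fun _ =>
      isClosed_le continuous_const (continuous_apply u)
  have hdisj : Disjoint (expectedSatisfaction A '' M) K := by
    rw [Set.disjoint_left]
    rintro _ ⟨E, hE, rfl⟩ hK
    obtain ⟨D, hD, hlt⟩ := hno E hE.1 hK
    exact (hE.2 D hD).not_gt hlt
  -- If no maximizer of `T` dominates `x` on `T`, a functional `ℓ` is strictly smaller on the
  -- maximizers than on `K`. A greedy distribution for its coefficients will contradict this.
  obtain ⟨ℓ, s, t, hs, hst, ht⟩ := geometric_hahn_banach_compact_closed hMconv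
    (hMcomp.image (continuous_expectedSatisfaction A)) hKconv hKclosed hdisj
  let w : U → ℝ := fun u => ℓ (Pi.single u 1)
  have hℓ : ∀ y, ℓ y = ∑ u, w u * y u := by
    intro y
    have hy : y = ∑ u, y u • (Pi.single u 1 : U → ℝ) := by
      ext v
      simp [Finset.sum_apply, Pi.single_apply]
    conv_lhs => rw [hy]
    rw [map_sum]
    exact Finset.sum_congr rfl fun u _ => by rw [map_smul, smul_eq_mul, mul_comm]
  have hxt : t < ℓ x := ht x fun u _ => le_rfl
  -- `K` is closed under these directions and `ℓ` is bounded below on it. Off `T` both signs of `c`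
  -- are allowed, which forces `w u = 0` there.
  have hray : ∀ u, ∀ c : ℝ, (u ∈ T → 0 ≤ c) → 0 ≤ c * w u := by
    intro u c hc
    by_contra! hneg
    have hN : 0 < (ℓ x - t) / -(c * w u) := div_pos (by linarith) (by linarith)
    have h := ht (x + ((ℓ x - t) / -(c * w u) * c) • (Pi.single u 1 : U → ℝ)) (by
      intro v hv
      by_cases huv : v = u
      · subst huv
        simpa using mul_nonneg hN.le (hc hv)
      · simp [huv])
    rw [map_add, map_smul, smul_eq_mul, mul_assoc, div_neg, neg_mul,
      div_mul_cancel₀ _ hneg.ne] at h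
    linarith
  have hwT : ∀ u, 0 ≤ w u := fun u => by simpa using hray u 1 fun _ => zero_le_one
  have hwT' : ∀ u ∉ T, w u = 0 := fun u hu =>
    le_antisymm (by simpa using hray u (-1) fun h => absurd h hu) (hwT u)
  -- The value `-1` off `T` makes `T` itself the level set at `0`, even where `w` vanishes on `T`;
  -- hence `E` lies in `M`.
  obtain ⟨E, hE, hmax⟩ := hA.exists_forall_upper_sum_le fun u => if u ∈ T then w u else -1
  have hT : (Finset.univ.filter fun u => (0 : ℝ) ≤ if u ∈ T then w u else -1) = T := by
    ext u
    by_cases hu : u ∈ T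
    · simp [hu, hwT u]
    · simp [hu]
  have hEM : E ∈ M := ⟨hE, fun D hD => by simpa only [hT] using hmax D hD 0⟩
  have habel := sum_mul_nonneg_of_sum_eq_zero (fun u => if u ∈ T then w u else -1)
    (fun u => expectedSatisfaction A E u - x u) w
    (fun u v huv => by
      by_cases hu : u ∈ T <;> by_cases hv : v ∈ T
      · simpa [hu, hv] using huv
      · simp only [hu, hv, if_true, if_false] at huv
        linarith [hwT u]
      · rw [hwT' u hu]
        exact hwT v
      · rw [hwT' u hu, hwT' v hv])
    (fun b => by
      rw [Finset.sum_sub_distrib]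
      exact sub_nonneg.2 (hmax F hF b))
    (by rw [Finset.sum_sub_distrib, hA.sum_eq E hE F hF, sub_self])
  have hlt := hs _ ⟨E, hEM, rfl⟩
  simp only [mul_sub, Finset.sum_sub_distrib, ← hℓ] at habel
  linarith

/-- A maxmin-fair distribution maximizes the total satisfaction of its lower level sets. -/
theorem tight_of_isMaxminFair (hA : IsGreedy A) {F : S → ℝ} (hF : IsMaxminFair A F) (a : ℝ)
    {D : S → ℝ} (hD : D ∈ stdSimplex ℝ S) :
    ∑ u with expectedSatisfaction A F u ≤ a, expectedSatisfaction A D u ≤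
      ∑ u with expectedSatisfaction A F u ≤ a, expectedSatisfaction A F u := by
  obtain ⟨E, hE, hge, hmax⟩ := hA.exists_ge_on_maximizing hF.1
    (Finset.univ.filter fun u => expectedSatisfaction A F u ≤ a)
  refine (hmax D hD).trans (Finset.sum_le_sum fun u hu => ?_)
  by_contra! hlt
  obtain ⟨v, hv, hvu⟩ := hF.2 E hE u hlt
  exact hv.not_ge (hge v (by simpa using hvu.trans (Finset.mem_filter.1 hu).2))

end IsGreedy

end Greedy

/-! ### Supergradients and concave welfare. -/

/-- A concave function on the line has a supergradient at each point. -/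
theorem ConcaveOn.exists_supergradient {φ : ℝ → ℝ} (hφ : ConcaveOn ℝ Set.univ φ) (x : ℝ) :
    ∃ c, ∀ y, φ y ≤ φ x + c * (y - x) := by
  have hle : ∀ y z, y < x → x < z → (φ z - φ x) / (z - x) ≤ (φ x - φ y) / (x - y) :=
    fun y z hy hz => hφ.slope_anti_adjacent trivial trivial hy hz
  let B : Set ℝ := (fun z => (φ z - φ x) / (z - x)) '' Set.Ioi x
  have hBne : B.Nonempty := ⟨_, x + 1, by simp, rfl⟩
  have hBbdd : BddAbove B := by
    refine ⟨(φ x - φ (x - 1)) / (x - (x - 1)), ?_⟩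
    rintro _ ⟨z, hz, rfl⟩
    exact hle _ z (by linarith) hz
  -- The supremum of the slopes to the right of `x` is at most every slope to its left.
  refine ⟨sSup B, fun y => ?_⟩
  rcases lt_trichotomy y x with hy | rfl | hy
  · have h : sSup B ≤ (φ x - φ y) / (x - y) := by
      refine csSup_le hBne ?_
      rintro _ ⟨z, hz, rfl⟩
      exact hle y z hy hz
    rw [le_div_iff₀ (by linarith)] at h
    linarith
  · simp
  · have h : (φ y - φ x) / (y - x) ≤ sSup B := le_csSup hBbdd ⟨y, hy, rfl⟩
    rw [div_le_iff₀ (by linarith)] at h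
    linarith

/-- A maxmin-fair distribution over a greedy system maximizes every separable symmetric concave
social welfare function. -/
theorem IsGreedy.isMaxOn_sum_concave {S U : Type*} [Fintype S] [Fintype U] {A : S → U → ℝ}
    (hA : IsGreedy A) {φ : ℝ → ℝ} (hφ : ConcaveOn ℝ Set.univ φ) {F : S → ℝ}
    (hF : IsMaxminFair A F) :
    IsMaxOn (fun D : S → ℝ => ∑ u, φ (expectedSatisfaction A D u)) (stdSimplex ℝ S) F := by
  intro D hD
  choose c hc using hφ.exists_supergradient
  set x := expectedSatisfaction A F with hx
  set y := expectedSatisfaction A D with hy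
  have hanti : ∀ p q, p ≤ q → c q ≤ c p := by
    intro p q hpq
    rcases hpq.eq_or_lt with rfl | hlt
    · exact le_rfl
    have h1 := hc p q
    have h2 := hc q p
    by_contra! h
    nlinarith [mul_pos (sub_pos.2 h) (sub_pos.2 hlt)]
  have habel := sum_mul_nonneg_of_sum_eq_zero (fun u => -x u) (fun u => x u - y u)
    (fun u => c (x u)) (fun u v huv => hanti _ _ (neg_le_neg_iff.1 huv))
    (fun b => by
      have h := hA.tight_of_isMaxminFair hF (-b) hD
      simp only [Finset.sum_sub_distrib, sub_nonneg, le_neg (a := b)]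
      exact h)
    (by rw [Finset.sum_sub_distrib, hA.sum_eq F hF.1 D hD, sub_self])
  change ∑ u, φ (y u) ≤ ∑ u, φ (x u)
  calc ∑ u, φ (y u) ≤ ∑ u, (φ (x u) + c (x u) * (y u - x u)) :=
        Finset.sum_le_sum fun u _ => hc (x u) (y u)
    _ = ∑ u, φ (x u) - ∑ u, c (x u) * (x u - y u) := by
        rw [← Finset.sum_sub_distrib]
        exact Finset.sum_congr rfl fun u _ => by ring
    _ ≤ ∑ u, φ (x u) := by linarith

/-! ### Greedy rankings under upper bounds. -/

namespace RankingInstance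

variable {U : Type*} [Fintype U] {n t : ℕ}

/-- A state of the greedy algorithm that fills the positions from the top, always with an individual
of largest `κ` among those that the upper bounds admit: `X` is the set of the individuals on the
first `m` positions. -/
structure IsGreedyPrefix (I : RankingInstance U n t) (κ : U → ℝ) (m : ℕ) (X : Finset U) :
    Prop where
  card_eq : X.card = m
  card_le_upper : ∀ (j : Fin n) (k : Fin t), m ≤ j + 1 →
    (X.filter fun u => I.group u = k).card ≤ I.upper j k
  le_of_mem_of_notMem : ∀ u ∈ X, ∀ v ∉ X, I.group u = I.group v → κ v ≤ κ u
  card_le : ∀ r ∈ I.validRankings, ∀ a : ℝ,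
    (Finset.univ.filter fun u => (r u : ℕ) < m ∧ a ≤ κ u).card ≤ (X.filter fun u => a ≤ κ u).card

theorem isGreedyPrefix_empty (I : RankingInstance U n t) (κ : U → ℝ) :
    I.IsGreedyPrefix κ 0 ∅ := by
  constructor <;> simp

/-- The first `m` positions of a valid ranking obey all upper bounds of later positions. -/
theorem card_filter_lt_le_upper (I : RankingInstance U n t) {r : U ≃ Fin n}
    (hr : r ∈ I.validRankings) {m : ℕ} {j : Fin n} (hmj : m ≤ j + 1) (k : Fin t) :
    (Finset.univ.filter fun u => (r u : ℕ) < m ∧ I.group u = k).card ≤ I.upper j k := by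
  refine le_trans (Finset.card_le_card fun u hu => ?_) (hr j k).2
  simp only [Finset.mem_filter, Finset.mem_univ, true_and] at hu ⊢
  exact ⟨hu.2, Fin.le_def.2 (by omega)⟩

theorem card_filter_lt (r : U ≃ Fin n) {m : ℕ} (hm : m ≤ n) :
    (Finset.univ.filter fun u => (r u : ℕ) < m).card = m := by
  have h : (Finset.univ.filter fun u => (r u : ℕ) < m).card =
      (Finset.univ.filter fun i : Fin n => (i : ℕ) < m).card :=
    Finset.card_equiv r fun u => by simp
  rw [h, Fin.card_filter_val_lt, min_eq_right hm]

/-- Below full length, the upper bounds always admit a further individual. -/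
theorem IsGreedyPrefix.exists_admissible [DecidableEq U] {I : RankingInstance U n t}
    {κ : U → ℝ} {m : ℕ} {X : Finset U} (hX : I.IsGreedyPrefix κ m X) (hm : m < n)
    {r : U ≃ Fin n} (hr : r ∈ I.validRankings) :
    ∃ u ∉ X, ∀ j : Fin n, m ≤ j →
      (X.filter fun v => I.group v = I.group u).card < I.upper j (I.group u) := by
  have hcard : X.card < (Finset.univ.filter fun u => (r u : ℕ) < m + 1).card := by
    rw [card_filter_lt r hm, hX.card_eq]
    exact Nat.lt_succ_self m
  rw [Finset.card_eq_sum_card_fiberwise (f := I.group) (t := Finset.univ) (by simp),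
    Finset.card_eq_sum_card_fiberwise (s := Finset.univ.filter fun u => (r u : ℕ) < m + 1)
      (f := I.group) (t := Finset.univ) (by simp)] at hcard
  -- Some group is larger in the first `m + 1` positions of `r` than in `X`, so the bounds obeyed by
  -- `r` leave room for it.
  obtain ⟨k, -, hk⟩ := Finset.exists_lt_of_sum_lt hcard
  obtain ⟨u, hu, huX⟩ := Finset.exists_mem_notMem_of_card_lt_card hk
  simp only [Finset.mem_filter, Finset.mem_univ, true_and] at hu huX
  obtain ⟨hu1, rfl⟩ := hu
  refine ⟨u, fun h => huX ⟨h, rfl⟩, fun j hj => hk.trans_le ?_⟩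
  rw [Finset.filter_filter]
  exact I.card_filter_lt_le_upper hr (by omega) _

/-- Admissibility depends only on the group, so choosing the largest admissible `κ` also takes the
best remaining member of its group. -/
theorem IsGreedyPrefix.exists_insert [DecidableEq U] {I : RankingInstance U n t}
    {κ : U → ℝ} {m : ℕ} {X : Finset U} (hX : I.IsGreedyPrefix κ m X) (hm : m < n)
    (hne : I.validRankings.Nonempty) : ∃ u ∉ X, I.IsGreedyPrefix κ (m + 1) (insert u X) := by
  classical
  obtain ⟨r₀, hr₀⟩ := hne
  let Q : Finset U := Finset.univ.filter fun u => u ∉ X ∧ ∀ j : Fin n, m ≤ j →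
      (X.filter fun v => I.group v = I.group u).card < I.upper j (I.group u)
  have hQ : Q.Nonempty := by
    obtain ⟨u, hu⟩ := hX.exists_admissible hm hr₀
    exact ⟨u, Finset.mem_filter.2 ⟨Finset.mem_univ u, hu⟩⟩
  obtain ⟨u, huQ, hmax⟩ := Q.exists_max_image κ hQ
  obtain ⟨huX, hadm⟩ := (Finset.mem_filter.1 huQ).2
  refine ⟨u, huX, ?_, ?_, ?_, ?_⟩
  · rw [Finset.card_insert_of_notMem huX, hX.card_eq]
  · intro j k hj
    rw [Finset.filter_insert]
    split_ifs with hk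
    · subst hk
      exact (Finset.card_insert_le _ _).trans (hadm j (by omega))
    · exact hX.card_le_upper j k (by omega)
  · intro v hv v' hv' hgroup
    rw [Finset.mem_insert, not_or] at hv'
    rcases Finset.mem_insert.1 hv with rfl | hv
    · refine hmax v' (Finset.mem_filter.2 ⟨Finset.mem_univ v', hv'.2, ?_⟩)
      rw [← hgroup]
      exact hadm
    · exact hX.le_of_mem_of_notMem v hv v' hv'.2 hgroup
  · intro r hr a
    by_cases hau : a ≤ κ u
    · rw [Finset.filter_insert, if_pos hau,
        Finset.card_insert_of_notMem fun h => huX (Finset.mem_filter.1 h).1]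
      have hsub : (Finset.univ.filter fun v => (r v : ℕ) < m + 1 ∧ a ≤ κ v) ⊆
          insert (r.symm ⟨m, hm⟩) (Finset.univ.filter fun v => (r v : ℕ) < m ∧ a ≤ κ v) := by
        intro v hv
        simp only [Finset.mem_insert, Finset.mem_filter, Finset.mem_univ, true_and] at hv ⊢
        rcases (Nat.lt_succ_iff.1 hv.1).lt_or_eq with h | h
        · exact Or.inr ⟨h, hv.2⟩
        · exact Or.inl (r.eq_symm_apply.2 (Fin.ext h))
      exact (Finset.card_le_card hsub).trans ((Finset.card_insert_le _ _).trans
        (Nat.succ_le_succ (hX.card_le r hr a)))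
    · rw [Finset.filter_insert, if_neg hau,
        Finset.card_eq_sum_card_fiberwise (f := I.group) (t := Finset.univ) (by simp),
        Finset.card_eq_sum_card_fiberwise (s := X.filter fun v => a ≤ κ v)
          (f := I.group) (t := Finset.univ) (by simp)]
      refine Finset.sum_le_sum fun k _ => ?_
      -- Here `κ u < a`, and the count is compared group by group. If a group still has a member `v`
      -- outside `X` with `a ≤ κ v`, then `v` is inadmissible: a bound of its group is saturated,
      -- and all members of that group in `X` lie in the level set.
      by_cases hall : ∀ v, a ≤ κ v → I.group v = k → v ∈ X
      · refine Finset.card_le_card fun v hv => ?_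
        simp only [Finset.mem_filter, Finset.mem_univ, true_and] at hv ⊢
        exact ⟨⟨hall v hv.1.2 hv.2, hv.1.2⟩, hv.2⟩
      · push Not at hall
        obtain ⟨v, hav, rfl, hvX⟩ := hall
        have hnot : v ∉ Q := fun h => hau (hav.trans (hmax v h))
        simp only [Q, Finset.mem_filter, Finset.mem_univ, true_and, not_and, not_forall,
          not_lt] at hnot
        obtain ⟨j, hj, hsat⟩ := hnot hvX
        calc _ ≤ (Finset.univ.filter fun w => (r w : ℕ) < m + 1 ∧ I.group w = I.group v).card := by
              refine Finset.card_le_card fun w hw => ?_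
              simp only [Finset.mem_filter, Finset.mem_univ, true_and] at hw ⊢
              exact ⟨hw.1.1, hw.2⟩
          _ ≤ I.upper j (I.group v) := I.card_filter_lt_le_upper hr (by omega) _
          _ ≤ _ := hsat
          _ ≤ _ := by
              refine Finset.card_le_card fun w hw => ?_
              simp only [Finset.mem_filter] at hw ⊢
              exact ⟨⟨hw.1, hav.trans (hX.le_of_mem_of_notMem w hw.1 v hvX hw.2)⟩, hw.2⟩

/-- With upper bounds only, for every weighting `κ` some valid ranking places at least as many
individuals of each upper level set of `κ` on each initial segment of positions as any other one. -/
theorem exists_validRanking_forall_card_le (I : RankingInstance U n t) (hI : I.OnlyUpperBounds)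
    (hne : I.validRankings.Nonempty) (κ : U → ℝ) :
    ∃ r₀ ∈ I.validRankings, ∀ r ∈ I.validRankings, ∀ (i : Fin n) (a : ℝ),
      (Finset.univ.filter fun u => r u ≤ i ∧ a ≤ κ u).card ≤
        (Finset.univ.filter fun u => r₀ u ≤ i ∧ a ≤ κ u).card := by
  classical
  have hstep : ∀ (m : ℕ) (X : Finset U), ∃ Y, m < n → I.IsGreedyPrefix κ m X →
      (∃ u ∉ X, Y = insert u X) ∧ I.IsGreedyPrefix κ (m + 1) Y := by
    intro m X
    by_cases h : m < n ∧ I.IsGreedyPrefix κ m X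
    · obtain ⟨u, hu, hY⟩ := h.2.exists_insert h.1 hne
      exact ⟨insert u X, fun _ _ => ⟨⟨u, hu, rfl⟩, hY⟩⟩
    · exact ⟨X, fun h1 h2 => absurd ⟨h1, h2⟩ h⟩
  choose next hnext using hstep
  let X : ℕ → Finset U := fun m => Nat.rec ∅ next m
  have hX : ∀ m ≤ n, I.IsGreedyPrefix κ m (X m) := by
    intro m
    induction m with
    | zero => exact fun _ => I.isGreedyPrefix_empty κ
    | succ m ih => exact fun hm => (hnext m (X m) hm (ih (by omega))).2
  have hins : ∀ i : Fin n, ∃ u ∉ X i, X (i + 1) = insert u (X i) := fun i =>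
    (hnext i (X i) i.2 (hX i i.2.le)).1
  choose e heX he using hins
  have hmono : ∀ m k, m + k ≤ n → X m ⊆ X (m + k) := by
    intro m k
    induction k with
    | zero => exact fun _ => subset_rfl
    | succ k ih =>
      intro hk
      refine (ih (by omega)).trans ?_
      have h := he ⟨m + k, by omega⟩
      rw [← add_assoc, h]
      exact Finset.subset_insert _ _
  have hmem : ∀ (i : Fin n) (m : ℕ), m ≤ n → (e i ∈ X m ↔ (i : ℕ) < m) := by
    intro i m hm
    constructor
    · intro h
      by_contra! hle
      obtain ⟨k, hk⟩ := Nat.exists_eq_add_of_le hle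
      exact heX i (hk ▸ hmono m k (by omega) h)
    · intro h
      obtain ⟨k, hk⟩ := Nat.exists_eq_add_of_le (Nat.succ_le_of_lt h)
      rw [hk]
      refine hmono (i + 1) k (by omega) ?_
      rw [he i]
      exact Finset.mem_insert_self _ _
  have hinj : Function.Injective e := by
    intro i j hij
    have h1 := (hmem i (j + 1) j.2).1 (hij ▸ (hmem j (j + 1) j.2).2 (Nat.lt_succ_self _))
    have h2 := (hmem j (i + 1) i.2).1 (hij ▸ (hmem i (i + 1) i.2).2 (Nat.lt_succ_self _))
    exact Fin.ext (by omega)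
  obtain ⟨r₁, -⟩ := id hne
  have hbij : Function.Bijective e :=
    (Fintype.bijective_iff_injective_and_card e).2 ⟨hinj, (Fintype.card_congr r₁).symm⟩
  let r₀ : U ≃ Fin n := (Equiv.ofBijective e hbij).symm
  have hr₀ : ∀ (i : Fin n) (u : U), r₀ u ≤ i ↔ u ∈ X (i + 1) := by
    intro i u
    obtain ⟨j, rfl⟩ := hbij.2 u
    have hj : r₀ (e j) = j := (Equiv.ofBijective e hbij).symm_apply_apply j
    rw [hj, hmem j (i + 1) i.2, Fin.le_def, Nat.lt_succ_iff]
  refine ⟨r₀, fun i k => ⟨by rw [hI i k]; exact Nat.zero_le _, ?_⟩, fun r hr i a => ?_⟩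
  · refine le_trans (Finset.card_le_card fun u hu => ?_) ((hX (i + 1) i.2).card_le_upper i k le_rfl)
    simp only [Finset.mem_filter, Finset.mem_univ, true_and, hr₀] at hu ⊢
    exact hu.symm
  · have h := (hX (i + 1) i.2).card_le r hr a
    have h1 : (Finset.univ.filter fun u => r₀ u ≤ i ∧ a ≤ κ u) =
        (X (i + 1)).filter fun u => a ≤ κ u := by
      ext u
      simp [hr₀]
    rw [h1]
    refine le_trans (Finset.card_le_card fun u hu => ?_) h
    simp only [Finset.mem_filter, Finset.mem_univ, true_and, Fin.le_def] at hu ⊢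
    exact ⟨by omega, hu.2⟩

/-- If `r₀` places at least as many individuals of `T` on each initial segment of positions as `r`,
then the total utility of `T` is at least as large. -/
theorem sum_antitone_le_of_card_le {f : Fin n → ℝ} (hf : Antitone f) (r r₀ : U ≃ Fin n)
    (T : Finset U) (h : ∀ i, (T.filter fun u => r u ≤ i).card ≤ (T.filter fun u => r₀ u ≤ i).card) :
    ∑ u ∈ T, f (r u) ≤ ∑ u ∈ T, f (r₀ u) := by
  classical
  have hsum : ∀ (q : U ≃ Fin n) (ψ : Fin n → ℝ),
      ∑ i, ψ i * (if q.symm i ∈ T then (1 : ℝ) else 0) = ∑ u ∈ T, ψ (q u) := by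
    intro q ψ
    rw [← Equiv.sum_comp q]
    simp [Finset.sum_ite_mem]
  have hcount : ∀ (q : U ≃ Fin n) (a : ℝ),
      ∑ i ∈ Finset.univ.filter (fun i : Fin n => a ≤ -((i : ℕ) : ℝ)),
        (if q.symm i ∈ T then (1 : ℝ) else 0) =
        (T.filter fun u => a ≤ -((q u : ℕ) : ℝ)).card := by
    intro q a
    have h := hsum q fun i => if a ≤ -((i : ℕ) : ℝ) then 1 else 0
    simp only [ite_mul, one_mul, zero_mul] at h
    rw [Finset.sum_filter, h, Finset.sum_boole]
  -- With `κ i = -i` the upper level sets are the initial segments of positions.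
  have habel := sum_mul_nonneg_of_sum_eq_zero (fun i : Fin n => -((i : ℕ) : ℝ))
    (fun i => (if r₀.symm i ∈ T then (1 : ℝ) else 0) - if r.symm i ∈ T then (1 : ℝ) else 0) f
    (fun i j hij => hf (Fin.le_def.2 (by exact_mod_cast neg_le_neg_iff.1 hij)))
    (fun a => by
      rw [Finset.sum_sub_distrib, hcount, hcount, sub_nonneg, Nat.cast_le]
      rcases (Finset.univ.filter fun i : Fin n => a ≤ -((i : ℕ) : ℝ)).eq_empty_or_nonempty with
        hempty | hnonempty
      · have hnone : ∀ i : Fin n, ¬ a ≤ -((i : ℕ) : ℝ) := fun i =>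
          Finset.filter_eq_empty_iff.1 hempty (Finset.mem_univ i)
        simp [hnone]
      · obtain ⟨i, hi, hmax⟩ := Finset.exists_max_image _ id hnonempty
        have hiff : ∀ j : Fin n, a ≤ -((j : ℕ) : ℝ) ↔ j ≤ i := by
          intro j
          constructor
          · exact fun hj => hmax j (Finset.mem_filter.2 ⟨Finset.mem_univ j, hj⟩)
          · intro hj
            have hji : ((j : ℕ) : ℝ) ≤ (i : ℕ) := by exact_mod_cast Fin.le_def.1 hj
            linarith [(Finset.mem_filter.1 hi).2]
        simp only [hiff]
        exact h i)
    (by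
      have h1 := hsum r₀ fun _ => 1
      have h2 := hsum r fun _ => 1
      simp only [one_mul] at h1 h2
      rw [Finset.sum_sub_distrib, h1, h2, sub_self])
  simp only [mul_sub, Finset.sum_sub_distrib, hsum, sub_nonneg] at habel
  exact habel

theorem isGreedy_value (I : RankingInstance U n t) (hI : I.OnlyUpperBounds)
    (hne : I.validRankings.Nonempty) : IsGreedy I.value := by
  apply isGreedy_of_pure
  · intro κ
    obtain ⟨r₀, hr₀, hmax⟩ := I.exists_validRanking_forall_card_le hI hne κ
    refine ⟨⟨r₀, hr₀⟩, fun r a => ?_⟩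
    simp only [value, Finset.sum_sub_distrib]
    refine sub_le_sub_right (sum_antitone_le_of_card_le I.posUtility_antitone _ _ _ fun i => ?_) _
    simpa only [Finset.filter_filter, and_comm] using hmax r.1 r.2 i a
  · intro r r'
    simp only [value, Finset.sum_sub_distrib, Equiv.sum_comp]

end RankingInstance

theorem mainTheorem7 {U : Type*} [Fintype U] {n t : ℕ} (I : RankingInstance U n t)
    (hI : I.OnlyUpperBounds) (hne : I.validRankings.Nonempty) :
    (∃ F : I.validRankings → ℝ, IsMaxminFair I.value F) ∧
      ∀ φ : ℝ → ℝ, ConcaveOn ℝ Set.univ φ →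
        ∀ F : I.validRankings → ℝ, IsMaxminFair I.value F →
          IsMaxOn (fun D : I.validRankings → ℝ => ∑ u, φ (expectedSatisfaction I.value D u))
            (stdSimplex ℝ I.validRankings) F := by
  have hG := I.isGreedy_value hI hne
  exact ⟨hG.exists_isMaxminFair, fun φ hφ F hF => hG.isMaxOn_sum_concave hφ hF⟩
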